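/- For $m\ge 1$ let $B_m\in\{0,1\}^{m\times m}$ be the matrix whose entry $(i,j)$ is $1$ exactly when $j=i$, $j=i+1$ or $i=j+2$, and for $n\ge 2$ let $$\beta_n=\left(\begin{array}{c|c}\mathbf 0_{(n-1)\times 1}&B_{n-1}\\\hline 1&\mathbf 0_{1\times(n-1)}\end{array}\right)\in\{0,1\}^{n\times n}.$$ Consider the two-player game $(I_n,\beta_n)$, in which player 1 chooses a row, player 2 chooses a column, and for mixed strategies $x,y$ (probability vectors in $\mathbb R^n$) the expected payoffs are $x^{T}I_ny$ to player 1 and $x^{T}\beta_ny$ to player 2. There are constants $M,c,C>0$, independent of $n$, such that for every $n\ge 8$ the game $(I_n,\beta_n)$ has a unique Nash equilibrium $(x,y)$, and the strategy $x$ of player 1 has the following properties. 1. All $x_i$ are positive and $\max_{i,j}\frac{x_i}{x_j}\le M$. 2. The $x_i$ are rational, and if $x=\left(\frac{p_1}{q},\dots,\frac{p_n}{q}\right)$ is the unique representation with $p_1,\dots,p_n,q\in\mathbb N$, $q>0$ and $\gcd(p_1,\dots,p_n)=1$, then the total number of bits in the standard binary encodings of the numerators $p_1,\dots,p_n$ lies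 between $cn^2$ and $Cn^2$. That is, storing the numerators of $x$ takes $\Theta(n^2)$ bits. -/

import Mathlib

namespace BimatrixGame

/-- Expected payoff `xᵀ A y` of the mixed strategy profile `(x, y)` under the payoff matrix `A`. -/
noncomputable def payoff {n : ℕ} (A : Matrix (Fin n) (Fin n) ℤ) (x y : Fin n → ℝ) : ℝ :=
  ∑ i, ∑ j, x i * (A i j : ℝ) * y j

/-- `(x, y)` is a (mixed) Nash equilibrium of the two-player game with payoff matrix `A` for
player 1 (who chooses the row) and `B` for player 2 (who chooses the column). -/
def IsNash {n : ℕ} (A B : Matrix (Fin n) (Fin n) ℤ) (x y : Fin n → ℝ) : Prop :=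
  x ∈ stdSimplex ℝ (Fin n) ∧ y ∈ stdSimplex ℝ (Fin n) ∧
    (∀ x' ∈ stdSimplex ℝ (Fin n), payoff A x' y ≤ payoff A x y) ∧
    (∀ y' ∈ stdSimplex ℝ (Fin n), payoff B x y' ≤ payoff B x y)

/-- The `m × m` matrix with ones exactly on the main diagonal, on the diagonal just above it, and
on the second diagonal below it. -/
def bandMatrix (m : ℕ) : Matrix (Fin m) (Fin m) ℤ :=
  Matrix.of fun i j =>
    if j.val = i.val ∨ j.val = i.val + 1 ∨ i.val = j.val + 2 then 1 else 0

/-- The `n × n` matrix with block form `[[0, bandMatrix (n - 1)], [1, 0]]`, whose upper left block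
is a column of length `n - 1` and whose lower right block is a row of length `n - 1`. -/
def beta : (n : ℕ) → Matrix (Fin n) (Fin n) ℤ
  | 0 => 0
  | m + 1 => Matrix.of fun i j =>
      Fin.lastCases (motive := fun _ => ℤ)
        (Fin.cases (motive := fun _ => ℤ) 1 (fun _ => 0) j)
        (fun i' => Fin.cases (motive := fun _ => ℤ) 0 (fun j' => bandMatrix m i' j') j)
        i

/-- `x = (p₁ / q, …, pₙ / q)` with natural numbers `q > 0` and `gcd (p₁, …, pₙ) = 1`: the `p i` are
the numerators of the distribution `x`, and `q` is their common denominator. -/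
def IsReducedForm {n : ℕ} (x : Fin n → ℝ) (p : Fin n → ℕ) (q : ℕ) : Prop :=
  0 < q ∧ Finset.univ.gcd p = 1 ∧ ∀ i, x i = (p i : ℝ) / (q : ℝ)

/-- Total length of the standard binary encodings of `p₁, …, pₙ`; the number `0` takes one bit. -/
def bitLength {n : ℕ} (p : Fin n → ℕ) : ℕ :=
  ∑ i, max 1 (Nat.digits 2 (p i)).length

end BimatrixGame

/-! Read `x` backwards without its last entry `v` and pad it with zeros to `Y 0, …, Y (m + 2)`,
where `n = m + 1`. If `x` has full support, then `y` is constant and all columns of `beta` are best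
responses. This says `Y k + Y (k + 2) + Y (k + 3) = v` with `Y 0 = Y 1 = Y (m + 2) = 0`. Full
support is forced: at an equilibrium, a vanishing entry makes some column exceed the maximal payoff
or forces that payoff to be zero (`IsNash.pos`, `band_pos`).

Subtracting the fixed point `v / 3` leaves the recurrence with characteristic polynomial `z^3 + z^2
+ 1`. It has one expanding real root, of modulus about 1.47, and a contracting complex pair. A
solution is therefore a part damped from the left plus a part damped from the right, and it stays
near `v / 3` in the middle. Explicit estimates near the two ends keep every entry at least `v / 100`
(`exists_isBandSolution`).

For the numerators, solving the system expresses `x i / v` with denominator the Narayana number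
`narayana (m + 2)`, which gives `O(n)` bits each. Conversely, an integral solution with `v` too
small would be so close to `v / 3` in the middle that it equals it at three consecutive places,
hence everywhere, contradicting `Y 0 = 0` (`five_quarters_pow_le`). As all entries are comparable,
each numerator has `Θ(n)` bits. -/

namespace BimatrixGame

/-! ### The band recurrence and its integral solutions -/

/-- Narayana's cows sequence, shifted so that it starts with two zeros. -/
def narayana : ℕ → ℕ
  | 0 => 0
  | 1 => 0
  | 2 => 1
  | k + 3 => narayana (k + 2) + narayana k

/-- The solution of the homogeneous band recurrence with initial values `0, 0, 1`. -/
def signedNarayana (k : ℕ) : ℤ := (-1) ^ k * narayana k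

/-- The solution of the band recurrence with right hand side `1` and initial values `0, 0, 0`. -/
def inhomogeneous : ℕ → ℤ
  | 0 => 0
  | 1 => 0
  | 2 => 0
  | k + 3 => 1 - inhomogeneous (k + 2) - inhomogeneous k

theorem signedNarayana_add_three (k : ℕ) :
    signedNarayana (k + 3) = -signedNarayana (k + 2) - signedNarayana k := by
  simp only [signedNarayana, narayana]
  push_cast
  ring

theorem narayana_le_succ (k : ℕ) : narayana k ≤ narayana (k + 1) := by
  match k with
  | 0 => simp [narayana]
  | 1 => simp [narayana]
  | k + 2 => simp [narayana]

theorem narayana_monotone : Monotone narayana := monotone_nat_of_le_succ narayana_le_succ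

theorem narayana_pos {k : ℕ} (hk : 2 ≤ k) : 0 < narayana k :=
  lt_of_lt_of_le (by simp [narayana]) (narayana_monotone hk)

theorem two_mul_narayana_le (k : ℕ) : 2 * narayana (k + 3) ≤ narayana (k + 5) := by
  have h1 : narayana (k + 5) = narayana (k + 4) + narayana (k + 2) := rfl
  have h2 : narayana (k + 4) = narayana (k + 3) + narayana (k + 1) := rfl
  have h3 : narayana (k + 3) = narayana (k + 2) + narayana k := rfl
  have := narayana_le_succ k
  omega

theorem narayana_le_two_pow (k : ℕ) : narayana k ≤ 2 ^ k := by
  induction k with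
  | zero => simp [narayana]
  | succ k ih =>
    match k with
    | 0 => simp [narayana]
    | 1 => simp [narayana]
    | k + 2 =>
      have h : narayana (k + 3) = narayana (k + 2) + narayana k := rfl
      have h2 : narayana k ≤ narayana (k + 2) := narayana_monotone (by omega)
      change narayana (k + 3) ≤ _
      rw [pow_succ]
      omega

theorem signedNarayana_ne_zero {k : ℕ} (hk : 2 ≤ k) : signedNarayana k ≠ 0 := by
  have := narayana_pos hk
  simp only [signedNarayana]
  exact mul_ne_zero (pow_ne_zero _ (by norm_num)) (by exact_mod_cast this.ne')

theorem natAbs_signedNarayana (k : ℕ) : (signedNarayana k).natAbs = narayana k := by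
  simp [signedNarayana, Int.natAbs_mul, Int.natAbs_pow]

/-- `Y` solves the band system of order `m` with constant right hand side `v`; the entries
of the solution are `Y 2, …, Y (m + 1)`. -/
structure IsBandSolution {R : Type*} [CommRing R] (m : ℕ) (v : R) (Y : ℕ → R) : Prop where
  zero : Y 0 = 0
  one : Y 1 = 0
  last : Y (m + 2) = 0
  step : ∀ k < m, Y k + Y (k + 2) + Y (k + 3) = v

namespace IsBandSolution

variable {R : Type*} [CommRing R] {m : ℕ} {v : R} {Y : ℕ → R}

theorem eq_add (h : IsBandSolution m v Y) {k : ℕ} (hk : k ≤ m + 2) :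
    Y k = inhomogeneous k * v + signedNarayana k * Y 2 := by
  induction k using Nat.strong_induction_on with
  | _ k ih =>
    match k with
    | 0 => simp [h.zero, inhomogeneous, signedNarayana, narayana]
    | 1 => simp [h.one, inhomogeneous, signedNarayana, narayana]
    | 2 => simp [inhomogeneous, signedNarayana, narayana]
    | k + 3 =>
      have h1 := h.step k (by omega)
      have h2 := ih k (by omega) (by omega)
      have h3 := ih (k + 2) (by omega) (by omega)
      rw [signedNarayana_add_three, inhomogeneous]
      push_cast
      linear_combination h1 - h2 - h3

/-- The condition `Y (m + 2) = 0` eliminates the free parameter `Y 2`. The integral coefficients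
yield uniqueness up to scaling, rationality and the bound on the numerators. -/
theorem signedNarayana_mul (h : IsBandSolution m v Y) {k : ℕ} (hk : k ≤ m + 2) :
    (signedNarayana (m + 2) : R) * Y k =
      ((signedNarayana (m + 2) * inhomogeneous k - inhomogeneous (m + 2) * signedNarayana k : ℤ)
        : R) * v := by
  have h1 := h.eq_add hk
  have h2 := h.eq_add le_rfl
  rw [h.last] at h2
  push_cast
  linear_combination (signedNarayana (m + 2) : R) * h1 - (signedNarayana k : R) * h2

end IsBandSolution

theorem IsBandSolution.mul_eq_mul {m : ℕ} {v v' : ℝ} {Y Y' : ℕ → ℝ} (h : IsBandSolution m v Y)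
    (h' : IsBandSolution m v' Y') {k : ℕ} (hk : k ≤ m + 2) : v' * Y k = v * Y' k := by
  have hB : (signedNarayana (m + 2) : ℝ) ≠ 0 := by
    exact_mod_cast signedNarayana_ne_zero (by omega)
  apply mul_left_cancel₀ hB
  linear_combination v' * h.signedNarayana_mul hk - v * h'.signedNarayana_mul hk

/-! ### A positive solution bounded away from zero -/

section Existence

/-- A solution of the homogeneous band recurrence that is damped when `f ^ 3 + f = 1`. -/
def damped (f : ℝ) : ℕ → ℝ
  | 0 => -1
  | 1 => -1
  | k + 2 => f ^ 2 * damped f (k + 1) - f * damped f k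

/-- When `f ^ 3 + f = 1`, the polynomial `z^3 + z^2 + 1` factors as `(z + 1/f) (z^2 - f^2 z + f)`.
The quadratic factor carries the contracting roots, of modulus `√f`. -/
theorem damped_add_three {f : ℝ} (hf : f ^ 3 + f = 1) (k : ℕ) :
    damped f (k + 3) = -damped f (k + 2) - damped f k := by
  rw [damped, damped]
  linear_combination (damped f (k + 1) * f - damped f k) * hf

/-- The quadratic form that decays geometrically along `damped f`. -/
def energy (f : ℝ) (k : ℕ) : ℝ :=
  damped f (k + 1) ^ 2 - f ^ 2 * (damped f (k + 1) * damped f k) + f * damped f k ^ 2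

theorem energy_eq (f : ℝ) (k : ℕ) : energy f k = f ^ k * (1 + f - f ^ 2) := by
  induction k with
  | zero => simp only [energy, damped]; ring
  | succ k ih =>
    have : energy f (k + 1) = f * energy f k := by
      simp only [energy, damped]; ring
    rw [this, ih]; ring

theorem exists_cubic_root : ∃ f : ℝ, 0.682 ≤ f ∧ f ≤ 0.683 ∧ f ^ 3 + f = 1 := by
  have hc : ContinuousOn (fun f : ℝ => f ^ 3 + f) (Set.Icc 0.682 0.683) := by fun_prop
  have := intermediate_value_Icc (by norm_num) hc
  obtain ⟨f, hf, h⟩ := this (show (1 : ℝ) ∈ _ by constructor <;> norm_num)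
  exact ⟨f, hf.1, hf.2, h⟩

theorem abs_damped_le {f : ℝ} (h1 : 0.682 ≤ f) (h2 : f ≤ 0.683) (hf : f ^ 3 + f = 1) {k : ℕ}
    (hk : 8 ≤ k) : |damped f k| ≤ 0.31 := by
  obtain ⟨j, rfl⟩ := Nat.exists_eq_add_of_le' hk
  have hE := energy_eq f (j + 7)
  have hle : f ^ (j + 7) ≤ f ^ 7 := pow_le_pow_of_le_one (by linarith) (by linarith) (by omega)
  have h7 : f ^ 7 ≤ 0.683 ^ 7 := pow_le_pow_left₀ (by linarith) h2 7
  have hq : 1 + f - f ^ 2 ≤ 1.219 := by nlinarith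
  have hq0 : 0 ≤ 1 + f - f ^ 2 := by nlinarith
  have hE2 : energy f (j + 7) ≤ 0.683 ^ 7 * 1.219 := by
    rw [hE]
    exact mul_le_mul (hle.trans h7) hq hq0 (by norm_num)
  -- Completing the square leaves the coefficient `1 - f^3 / 4`, which is `(3 + f) / 4` by the cubic
  -- equation.
  have hsq : (3 + f) / 4 * damped f (j + 8) ^ 2 ≤ energy f (j + 7) := by
    have : energy f (j + 7) = (3 + f) / 4 * damped f (j + 8) ^ 2
        + f * (damped f (j + 7) - f / 2 * damped f (j + 8)) ^ 2 := by
      rw [energy]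
      linear_combination (-damped f (j + 8) ^ 2 / 4) * hf
    rw [this]
    have : 0 ≤ f * (damped f (j + 7) - f / 2 * damped f (j + 8)) ^ 2 :=
      mul_nonneg (by linarith) (sq_nonneg _)
    linarith
  apply abs_le_of_sq_le_sq _ (by norm_num)
  have : 0.92 * damped f (j + 8) ^ 2 ≤ (3 + f) / 4 * damped f (j + 8) ^ 2 :=
    mul_le_mul_of_nonneg_right (by linarith) (sq_nonneg _)
  norm_num at *
  linarith

/-- All these values are affine in `damped f 2 = f - f ^ 2`, which is about 0.217. -/
theorem damped_small {f : ℝ} (h1 : 0.682 ≤ f) (h2 : f ≤ 0.683) (hf : f ^ 3 + f = 1) :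
    0 ≤ damped f 2 ∧ 0 ≤ damped f 3 ∧ 0 ≤ damped f 4 ∧ -0.44 ≤ damped f 5 ∧
      -0.36 ≤ damped f 6 ∧ 0 ≤ damped f 7 := by
  have e2 : damped f 2 = f - f ^ 2 := by simp only [damped]; ring
  have e3 : damped f 3 = 1 - damped f 2 := by
    rw [damped_add_three hf]; simp only [damped]; ring
  have e4 : damped f 4 = damped f 2 := by
    rw [damped_add_three hf, e3]; simp only [damped]; ring
  have e5 : damped f 5 = -2 * damped f 2 := by
    rw [damped_add_three hf, e4]; ring
  have e6 : damped f 6 = 3 * damped f 2 - 1 := by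
    rw [damped_add_three hf, e5, e3]; ring
  have e7 : damped f 7 = 1 - 4 * damped f 2 := by
    rw [damped_add_three hf, e6, e4]; ring
  have hl : 0.216 ≤ damped f 2 := by rw [e2]; nlinarith
  have hu : damped f 2 ≤ 0.218 := by rw [e2]; nlinarith
  rw [e7, e6, e5, e4, e3]
  norm_num at *
  refine ⟨?_, ?_, ?_, ?_, ?_, ?_⟩ <;> linarith

/-- The damped solution meets the two conditions on the left. A multiple of `signedNarayana`, which
vanishes at 0 and 1, corrects the value at `M` and decays away from the right end. -/
theorem exists_homogeneous {M : ℕ} (hM : 9 ≤ M) :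
    ∃ W : ℕ → ℝ, W 0 = -1 ∧ W 1 = -1 ∧ W M = -1 ∧ (∀ k, W (k + 3) = -W (k + 2) - W k) ∧
      ∀ k, 2 ≤ k → k < M → -0.97 ≤ W k := by
  obtain ⟨f, h1, h2, hf⟩ := exists_cubic_root
  have hB : (signedNarayana M : ℝ) ≠ 0 := by
    exact_mod_cast signedNarayana_ne_zero (by omega)
  have hN : (0 : ℝ) < narayana M := by exact_mod_cast narayana_pos (by omega)
  have hN9 : (9 : ℝ) ≤ narayana M := by
    have : narayana 9 = 9 := rfl
    exact_mod_cast this ▸ narayana_monotone hM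
  have hM31 := abs_le.1 (abs_damped_le h1 h2 hf (show 8 ≤ M by omega))
  obtain ⟨r2, r3, r4, r5, r6, r7⟩ := damped_small h1 h2 hf
  refine ⟨fun k => damped f k + (-1 - damped f M) * (signedNarayana k / signedNarayana M),
    ?_, ?_, ?_, ?_, ?_⟩
  · simp [damped, signedNarayana, narayana]
  · simp [damped, signedNarayana, narayana]
  · simp [div_self hB]
  · intro k
    simp only [damped_add_three hf, signedNarayana_add_three]
    push_cast
    ring
  · intro k hk hkM
    simp only
    rcases Nat.lt_or_ge (k + 1) M with hlt | hge
    · have hbound : ∀ b : ℝ, (narayana k : ℝ) ≤ b * narayana M →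
          -(1.31 * b) ≤ (-1 - damped f M) * (signedNarayana k / signedNarayana M) := by
        intro b hb
        have habs : |(signedNarayana k / signedNarayana M : ℝ)| ≤ b := by
          rw [abs_div]
          simp only [signedNarayana, Int.cast_mul, Int.cast_pow, Int.cast_neg, Int.cast_one,
            Int.cast_natCast, abs_mul, abs_pow, abs_neg, abs_one, one_pow, one_mul, Nat.abs_cast]
          rwa [div_le_iff₀ hN]
        have h3 : |-1 - damped f M| ≤ 1.31 := by
          rw [abs_le]; norm_num at *; constructor <;> linarith
        have h4 := mul_le_mul h3 habs (abs_nonneg _) (by norm_num)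
        rw [← abs_mul] at h4
        exact (abs_le.1 h4).1
      rcases Nat.lt_or_ge k 8 with h8 | h8
      · have hb := hbound (narayana k / 9) (by
          rw [div_mul_eq_mul_div, le_div_iff₀ (by norm_num)]
          gcongr)
        interval_cases k <;> norm_num [narayana] at hb ⊢ <;> norm_num at * <;> linarith
      -- The tight case: two steps from the right end the correction has at least halved, and `0.31
      -- + 1.31 / 2 = 0.965`.
      · have hb := hbound (1 / 2) (by
          obtain ⟨j, rfl⟩ := Nat.exists_eq_add_of_le' (show 3 ≤ k by omega)
          have := (two_mul_narayana_le j).trans (narayana_monotone (show j + 5 ≤ M by omega))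
          have : (2 : ℝ) * narayana (j + 3) ≤ narayana M := by exact_mod_cast this
          linarith)
        have hr := abs_le.1 (abs_damped_le h1 h2 hf h8)
        norm_num at *
        linarith
    -- Next to the right end the correction is large, but the alternating sign makes it nonnegative.
    · obtain rfl : M = k + 1 := by omega
      have hr := abs_le.1 (abs_damped_le h1 h2 hf (show 8 ≤ k by omega))
      have hq : (signedNarayana k / signedNarayana (k + 1) : ℝ)
          = -(narayana k / narayana (k + 1)) := by
        simp only [signedNarayana, pow_succ]
        push_cast
        rcases neg_one_pow_eq_or ℝ k with h | h <;> rw [h] <;> field_simp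
      rw [hq]
      have : 0 ≤ (1 + damped f (k + 1)) * ((narayana k : ℝ) / narayana (k + 1)) :=
        mul_nonneg (by norm_num at *; linarith) (by positivity)
      norm_num at *
      linarith

theorem exists_isBandSolution {m : ℕ} (hm : 7 ≤ m) :
    ∃ Y : ℕ → ℝ, IsBandSolution m 1 Y ∧ ∀ k, 2 ≤ k → k ≤ m + 1 → 1 / 100 ≤ Y k := by
  obtain ⟨W, h0, h1, hM, hs, hp⟩ := exists_homogeneous (show 9 ≤ m + 2 by omega)
  refine ⟨fun k => (1 + W k) / 3, ⟨by simp [h0], by simp [h1], by simp [hM], ?_⟩, ?_⟩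
  · intro k _
    simp only [hs k]
    ring
  · intro k hk hk'
    have := hp k hk (by omega)
    norm_num at *
    linarith

end Existence

/-! ### Integral solutions are large -/

section LowerBound

/-- The recurrence has no root on the unit circle, so a bounded solution decays from both ends
inwards. Each round gains a factor 4/5 and gives up 8 indices on the left and 4 on the right. -/
theorem abs_le_of_homogeneous {L : ℕ} {w : ℕ → ℝ} {K : ℝ}
    (hw : ∀ k, k + 3 ≤ L → w k + w (k + 2) + w (k + 3) = 0) (hK : ∀ k ≤ L, |w k| ≤ K) (s : ℕ) :
    ∀ k, 8 * s ≤ k → k + 4 * s ≤ L → |w k| ≤ (4 / 5) ^ s * K := by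
  induction s with
  | zero => intro k _ hk; simpa using hK k (by omega)
  | succ s ih =>
    intro k hk hkL
    obtain ⟨j, rfl⟩ := Nat.exists_eq_add_of_le' (show 8 ≤ k by omega)
    have a0 := abs_le.1 (ih j (by omega) (by omega))
    have a4 := abs_le.1 (ih (j + 4) (by omega) (by omega))
    have a12 := abs_le.1 (ih (j + 12) (by omega) (by omega))
    -- The coefficients on the right have absolute sum 4 against 5 on the left, which is the
    -- contraction.
    have key : 5 * w (j + 8) = w (j + 12) + 2 * w (j + 4) - w j := by
      have e0 := hw j (by omega)
      have e1 := hw (j + 1) (by omega)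
      have e2 := hw (j + 2) (by omega)
      have e3 := hw (j + 3) (by omega)
      have e4 := hw (j + 4) (by omega)
      have e5 := hw (j + 5) (by omega)
      have e6 := hw (j + 6) (by omega)
      have e7 := hw (j + 7) (by omega)
      have e8 := hw (j + 8) (by omega)
      have e9 := hw (j + 9) (by omega)
      simp only [add_assoc, Nat.reduceAdd] at *
      linarith
    rw [abs_le, pow_succ]
    constructor <;> linarith

theorem eq_zero_of_homogeneous {L a : ℕ} {w : ℕ → ℝ}
    (hw : ∀ k, k + 3 ≤ L → w k + w (k + 2) + w (k + 3) = 0) (ha : a + 2 ≤ L)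
    (h0 : w a = 0) (h1 : w (a + 1) = 0) (h2 : w (a + 2) = 0) : w 0 = 0 := by
  induction a with
  | zero => exact h0
  | succ a ih =>
    have := hw a (by omega)
    refine ih (by omega) ?_ h0 h1
    simp only [add_assoc, Nat.reduceAdd] at *
    linarith

/-- Integral solutions of the band system are exponentially large. -/
theorem five_quarters_pow_le {m : ℕ} {V : ℤ} {Y : ℕ → ℤ} (h : IsBandSolution m V Y) (hV : 0 < V)
    (hY : ∀ k ≤ m + 2, 0 ≤ Y k ∧ Y k ≤ V) {s : ℕ} (hs : 12 * s ≤ m) :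
    (5 / 4 : ℝ) ^ s ≤ 2 * V := by
  by_contra! hlt
  set w : ℕ → ℤ := fun k => 3 * Y k - V with hwdef
  have hw : ∀ k, k + 3 ≤ m + 2 → (w k : ℝ) + w (k + 2) + w (k + 3) = 0 := by
    intro k hk
    have := h.step k (by omega)
    simp only [hwdef]
    norm_cast
    linarith
  have hK : ∀ k ≤ m + 2, |(w k : ℝ)| ≤ 2 * V := by
    intro k hk
    obtain ⟨h1, h2⟩ := hY k hk
    rw [abs_le]
    simp only [hwdef]
    norm_cast
    constructor <;> linarith
  have hsmall := abs_le_of_homogeneous (w := fun k => (w k : ℝ)) hw hK s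
  have hlt1 : (4 / 5 : ℝ) ^ s * (2 * V) < 1 := by
    calc (4 / 5 : ℝ) ^ s * (2 * V) < (4 / 5) ^ s * (5 / 4) ^ s := by gcongr
      _ = 1 := by rw [← mul_pow]; norm_num
  have hz : ∀ k, 8 * s ≤ k → k + 4 * s ≤ m + 2 → (w k : ℝ) = 0 := by
    intro k h1 h2
    have h3 := (hsmall k h1 h2).trans_lt hlt1
    have h4 : |w k| < 1 := by exact_mod_cast h3
    exact_mod_cast Int.abs_lt_one_iff.1 h4
  -- As `12 * s ≤ m`, the three indices from `8 * s` on lie in the range where the integers `w k`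
  -- vanish; but `w 0 = -V`.
  have h0 := eq_zero_of_homogeneous (w := fun k => (w k : ℝ)) (a := 8 * s) hw (by omega)
    (hz _ (by omega) (by omega)) (hz _ (by omega) (by omega)) (hz _ (by omega) (by omega))
  have h0' : w 0 = 0 := by exact_mod_cast h0
  simp only [hwdef, h.zero] at h0'
  omega

end LowerBound

/-- A nonnegative solution of the complementarity version of the band system has no zero entry. -/
theorem band_pos {m : ℕ} (hm : 7 ≤ m) {v : ℝ} (hv : 0 < v) {Y : ℕ → ℝ} (hY : ∀ k, 0 ≤ Y k)
    (h0 : Y 0 = 0) (h1 : Y 1 = 0) (hlast : Y (m + 2) = 0) (htop : 0 < Y (m + 1))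
    (hle : ∀ k < m, Y k + Y (k + 2) + Y (k + 3) ≤ v) (hzero : Y 2 + Y 3 = v)
    (heq : ∀ k < m, 0 < Y (k + 1) → Y k + Y (k + 2) + Y (k + 3) = v) :
    ∀ k, 2 ≤ k → k ≤ m + 1 → 0 < Y k := by
  intro k
  induction k using Nat.strong_induction_on with
  | _ k ih =>
    intro hk hkm
    by_contra hnot
    have hk0 : Y k = 0 := le_antisymm (not_lt.1 hnot) (hY k)
    have hkm' : k ≤ m := by
      by_contra hc
      obtain rfl : k = m + 1 := by omega
      exact hnot htop
    have l2 := hle 2 (by omega)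
    have l3 := hle 3 (by omega)
    have l1 := hle 1 (by omega)
    have e1 := heq 1 (by omega)
    have e2 := heq 2 (by omega)
    simp only [Nat.reduceAdd] at *
    obtain rfl | rfl | rfl | h5 : k = 2 ∨ k = 3 ∨ k = 4 ∨ 5 ≤ k := by omega
    · have := e2 (by linarith)
      linarith [hY 4, hY 6]
    · have := e1 (by linarith)
      linarith [hY 5]
    · have p2 := ih 2 (by omega) (by omega) (by omega)
      have p3 := ih 3 (by omega) (by omega) (by omega)
      have := e1 p2
      linarith
    · obtain ⟨j, rfl⟩ := Nat.exists_eq_add_of_le' h5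
      have pos : ∀ i, 2 ≤ i → i < j + 5 → 0 < Y i := fun i hi hi' => ih i hi' hi (by omega)
      have a3 := heq (j + 3) (by omega) (pos _ (by omega) (by omega))
      have a2 := heq (j + 2) (by omega) (pos _ (by omega) (by omega))
      have a1 := heq (j + 1) (by omega) (pos _ (by omega) (by omega))
      -- For `j = 0`, `heq` says nothing because `Y 1 = 0`; `hzero` takes its place.
      have a0 : Y j + Y (j + 2) + Y (j + 3) = v := by
        rcases Nat.eq_zero_or_pos j with rfl | hj
        · simp only [Nat.zero_add]; linarith
        · exact heq j (by omega) (pos _ (by omega) (by omega))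
      have b := hle (j + 4) (by omega)
      have p4 := pos (j + 4) (by omega) (by omega)
      have n1 := hY (j + 1)
      have n7 := hY (j + 7)
      have nj := hY j
      simp only [add_assoc, Nat.reduceAdd] at *
      -- With `Y (j + 5) = 0`, the equalities `a0`, `a2`, `a3` turn `b` into `Y j + Y (j + 7) ≤ 0`.
      have z7 : Y (j + 7) = 0 := by linarith
      have zj : Y j = 0 := by linarith
      have hj : j < 2 := by
        by_contra hc
        exact (pos j (by omega) (by omega)).ne' zj
      have p6 : 0 < Y (j + 6) := by linarith
      have c := heq (j + 5) (by omega) (by simpa [add_assoc] using p6)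
      simp only [add_assoc, Nat.reduceAdd] at c
      -- By `c`, `Y (j + 8) = v`. This overshoots the next inequality because `Y (j + 6) > 0`, or
      -- else contradicts `hlast`.
      rcases Nat.lt_or_ge (j + 6) m with hlt | hge
      · have d := hle (j + 6) hlt
        simp only [add_assoc, Nat.reduceAdd] at d
        linarith [hY (j + 9)]
      · obtain rfl : m = j + 6 := by omega
        simp only [add_assoc, Nat.reduceAdd] at *
        linarith


/-! ### Best responses and the payoffs of the columns -/

theorem sum_mul_le_iff_of_mem_stdSimplex {ι : Type*} [Fintype ι] [DecidableEq ι] {c z : ι → ℝ}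
    (hz : z ∈ stdSimplex ℝ ι) :
    (∀ z' ∈ stdSimplex ℝ ι, ∑ j, c j * z' j ≤ ∑ j, c j * z j) ↔
      ∃ v, (∀ j, c j ≤ v) ∧ ∀ j, 0 < z j → c j = v := by
  constructor
  · intro h
    have hle : ∀ j, c j ≤ ∑ j, c j * z j := by
      intro j
      have := h (Pi.single j 1) (single_mem_stdSimplex ℝ j)
      simpa [Pi.single_apply] using this
    refine ⟨∑ j, c j * z j, hle, fun j hj => ?_⟩
    set v := ∑ j, c j * z j with hv
    have hsum : ∑ j, (v - c j) * z j = 0 := by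
      simp only [sub_mul, Finset.sum_sub_distrib, ← Finset.mul_sum, hz.2]
      rw [← hv]; ring
    have h0 := (Finset.sum_eq_zero_iff_of_nonneg
      (fun i _ => mul_nonneg (sub_nonneg.2 (hle i)) (hz.1 i))).1 hsum j (Finset.mem_univ _)
    rcases mul_eq_zero.1 h0 with h1 | h1
    · linarith
    · exact absurd h1 hj.ne'
  · rintro ⟨v, hle, heq⟩ z' hz'
    have h1 : ∑ j, c j * z j = v := by
      rw [← mul_one v, ← hz.2, Finset.mul_sum]
      refine Finset.sum_congr rfl fun j _ => ?_
      rcases (hz.1 j).eq_or_lt with h | h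
      · rw [← h]; simp
      · rw [heq j h]
    rw [h1, ← mul_one v, ← hz'.2, Finset.mul_sum]
    exact Finset.sum_le_sum fun j _ => mul_le_mul_of_nonneg_right (hle j) (hz'.1 j)

theorem payoff_one {n : ℕ} (x y : Fin n → ℝ) : payoff 1 x y = ∑ i, y i * x i := by
  refine Finset.sum_congr rfl fun i _ => ?_
  simp [Matrix.one_apply, mul_comm]

theorem payoff_eq_sum_column {n : ℕ} (A : Matrix (Fin n) (Fin n) ℤ) (x y : Fin n → ℝ) :
    payoff A x y = ∑ j, (∑ i, x i * (A i j : ℝ)) * y j := by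
  rw [payoff, Finset.sum_comm]
  simp only [Finset.sum_mul]

theorem isNash_one_iff {n : ℕ} {B : Matrix (Fin n) (Fin n) ℤ} {x y : Fin n → ℝ} :
    IsNash 1 B x y ↔ x ∈ stdSimplex ℝ (Fin n) ∧ y ∈ stdSimplex ℝ (Fin n) ∧
      (∃ u, (∀ i, y i ≤ u) ∧ ∀ i, 0 < x i → y i = u) ∧
      ∃ v, (∀ j, ∑ i, x i * (B i j : ℝ) ≤ v) ∧
        ∀ j, 0 < y j → ∑ i, x i * (B i j : ℝ) = v := by
  simp only [IsNash, payoff_one, payoff_eq_sum_column B]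
  refine and_congr_right fun hx => and_congr_right fun hy => ?_
  rw [sum_mul_le_iff_of_mem_stdSimplex hx, sum_mul_le_iff_of_mem_stdSimplex hy]

/-- The entries `x 0, …, x (m - 1)` in reverse order, placed at `m + 1, …, 2` and extended by
zero. -/
def rev {R : Type*} [Zero R] {m : ℕ} (x : Fin (m + 1) → R) (t : ℕ) : R :=
  if h : 2 ≤ t ∧ t ≤ m + 1 then x ⟨m + 1 - t, by omega⟩ else 0

section rev

variable {m : ℕ}

theorem rev_of_lt {R : Type*} [Zero R] (x : Fin (m + 1) → R) {t : ℕ} (ht : t < 2) :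
    rev x t = 0 := dif_neg (by omega)

theorem rev_of_gt {R : Type*} [Zero R] (x : Fin (m + 1) → R) {t : ℕ} (ht : m + 1 < t) :
    rev x t = 0 := dif_neg (by omega)

theorem rev_add_one_sub {R : Type*} [Zero R] (x : Fin (m + 1) → R) {i : ℕ} (hi : i < m) :
    rev x (m + 1 - i) = x ⟨i, by omega⟩ := by
  rw [rev, dif_pos (by omega)]
  congr 2
  omega

theorem rev_map {R S : Type*} [Zero R] [Zero S] (f : R → S) (hf : f 0 = 0)
    (x : Fin (m + 1) → R) (t : ℕ) : rev (fun i => f (x i)) t = f (rev x t) := by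
  unfold rev
  split_ifs
  · rfl
  · exact hf.symm

theorem sum_mul_beta_zero (x : Fin (m + 1) → ℝ) :
    ∑ i, x i * (beta (m + 1) i 0 : ℝ) = x (Fin.last m) := by
  rw [Fin.sum_univ_castSucc]
  simp [beta]

/-- Reversing the order turns the columns into a forward recurrence; the zero padding absorbs the
columns truncated at the borders of the band. -/
theorem sum_mul_beta_succ (x : Fin (m + 1) → ℝ) {k : ℕ} (hk : k < m) :
    ∑ i, x i * (beta (m + 1) i ⟨m - k, by omega⟩ : ℝ) =
      rev x k + rev x (k + 2) + rev x (k + 3) := by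
  have hc : (⟨m - k, by omega⟩ : Fin (m + 1)) = Fin.succ ⟨m - k - 1, by omega⟩ := by
    ext; simp; omega
  rw [hc, Fin.sum_univ_castSucc]
  simp only [beta, Matrix.of_apply, Fin.lastCases_castSucc, Fin.lastCases_last, Fin.cases_succ,
    bandMatrix, Int.cast_zero, mul_zero, add_zero]
  have hx : ∀ i : Fin m, x i.castSucc = rev x (m + 1 - i) := fun i => (rev_add_one_sub x i.2).symm
  simp only [hx]
  rw [Fin.sum_univ_eq_sum_range (fun i => rev x (m + 1 - i) *
    ((if m - k - 1 = i ∨ m - k - 1 = i + 1 ∨ i = m - k - 1 + 2 then 1 else 0 : ℤ) : ℝ))]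
  have hsplit : ∀ i ∈ Finset.range m, rev x (m + 1 - i) *
      ((if m - k - 1 = i ∨ m - k - 1 = i + 1 ∨ i = m - k - 1 + 2 then 1 else 0 : ℤ) : ℝ) =
      (if i = m - k - 1 + 2 then rev x k else 0) + (if i = m - k - 1 then rev x (k + 2) else 0)
        + (if i + 1 = m - k - 1 then rev x (k + 3) else 0) := by
    intro i hi
    rw [Finset.mem_range] at hi
    by_cases h1 : i = m - k - 1 + 2
    · rw [if_pos (by omega), if_pos h1, if_neg (by omega), if_neg (by omega),
        show m + 1 - i = k by omega]
      simp
    by_cases h2 : i = m - k - 1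
    · rw [if_pos (by omega), if_neg h1, if_pos h2, if_neg (by omega),
        show m + 1 - i = k + 2 by omega]
      simp
    by_cases h3 : i + 1 = m - k - 1
    · rw [if_pos (by omega), if_neg h1, if_neg h2, if_pos h3,
        show m + 1 - i = k + 3 by omega]
      simp
    · rw [if_neg (by omega), if_neg h1, if_neg h2, if_neg h3]
      simp
  rw [Finset.sum_congr rfl hsplit, Finset.sum_add_distrib, Finset.sum_add_distrib]
  congr 1
  · congr 1
    · rw [Finset.sum_ite_eq']
      split_ifs with h
      · rfl
      · rw [Finset.mem_range] at h
        exact (rev_of_lt x (by omega)).symm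
    · rw [Finset.sum_ite_eq', if_pos (Finset.mem_range.2 (by omega))]
  · rcases Nat.eq_zero_or_pos (m - k - 1) with h | h
    · rw [h, rev_of_gt x (by omega)]
      simp
    · rw [Finset.sum_eq_single (m - k - 1 - 1)]
      · rw [if_pos (by omega)]
      · intro b _ hb
        rw [if_neg (by omega)]
      · intro hb
        exact absurd (Finset.mem_range.2 (by omega)) hb

theorem forall_fin_iff {p : Fin (m + 1) → Prop} :
    (∀ j, p j) ↔ p 0 ∧ ∀ k, (hk : k < m) → p ⟨m - k, by omega⟩ := by
  refine ⟨fun h => ⟨h 0, fun k _ => h _⟩, fun ⟨h0, h⟩ j => ?_⟩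
  obtain ⟨j, hj⟩ := j
  rcases Nat.eq_zero_or_pos j with rfl | hpos
  · exact h0
  · have := h (m - j) (by omega)
    simpa [show m - (m - j) = j by omega] using this

end rev

/-! ### Full support, existence and uniqueness of the equilibrium -/

section Nash

variable {m : ℕ} {x y : Fin (m + 1) → ℝ}

theorem rev_nonneg (hx : ∀ i, 0 ≤ x i) (t : ℕ) : 0 ≤ rev x t := by
  unfold rev
  split_ifs
  · exact hx _
  · exact le_rfl

theorem exists_pos_of_mem_stdSimplex (hx : x ∈ stdSimplex ℝ (Fin (m + 1))) : ∃ i, 0 < x i := by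
  by_contra! h
  have := Finset.sum_nonpos fun i (_ : i ∈ Finset.univ) => h i
  rw [hx.2] at this
  linarith

/-- In an equilibrium of `(1, beta (m + 1))` both strategies have full support. -/
theorem IsNash.pos (hm : 7 ≤ m) (h : IsNash 1 (beta (m + 1)) x y) : ∀ i, 0 < x i := by
  obtain ⟨hx, hy, ⟨u, hu, hxu⟩, v, hv, hyv⟩ := isNash_one_iff.1 h
  have hu0 : 0 < u := by
    obtain ⟨i, hi⟩ := exists_pos_of_mem_stdSimplex hy
    exact hi.trans_le (hu i)
  -- Against the identity matrix, a row in the support of `x` is a column in the support of `y`,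
  -- hence a best response of player 2.
  have hxv : ∀ j, 0 < x j → ∑ i, x i * (beta (m + 1) i j : ℝ) = v :=
    fun j hj => hyv j (by rw [hxu j hj]; exact hu0)
  have hY := rev_nonneg hx.1
  have c0 : x (Fin.last m) ≤ v := sum_mul_beta_zero x ▸ hv 0
  have e0 : 0 < x 0 → x (Fin.last m) = v := sum_mul_beta_zero x ▸ hxv 0
  have c : ∀ k < m, rev x k + rev x (k + 2) + rev x (k + 3) ≤ v :=
    fun k hk => sum_mul_beta_succ x hk ▸ hv ⟨m - k, by omega⟩
  have hrev : ∀ k, 1 ≤ k → (hk : k < m) → rev x (k + 1) = x ⟨m - k, by omega⟩ := by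
    intro k hk hkm
    rw [← rev_add_one_sub x (by omega : m - k < m)]
    congr 1
    omega
  have e : ∀ k < m, 0 < rev x (k + 1) → rev x k + rev x (k + 2) + rev x (k + 3) = v := by
    intro k hk hpos
    rw [← sum_mul_beta_succ x hk]
    apply hxv
    rcases Nat.eq_zero_or_pos k with rfl | h1
    · rw [rev_of_lt x (by omega)] at hpos
      exact absurd hpos (lt_irrefl _)
    · rwa [hrev k h1 hk] at hpos
  have hx0 : rev x (m + 1) = x 0 := by
    have := rev_add_one_sub x (by omega : 0 < m)
    simpa using this
  have elast : 0 < x (Fin.last m) → rev x 2 + rev x 3 = v := by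
    intro hpos
    have h1 := sum_mul_beta_succ x (show 0 < m by omega)
    rw [rev_of_lt x (by omega : 0 < 2)] at h1
    have h2 := hxv (Fin.last m) hpos
    have h3 : (⟨m - 0, by omega⟩ : Fin (m + 1)) = Fin.last m := rfl
    rw [h3, h2] at h1
    simpa using h1.symm
  have hvpos : 0 < v := by
    by_contra hneg
    have hv0 : v ≤ 0 := not_lt.1 hneg
    obtain ⟨i, hi⟩ := exists_pos_of_mem_stdSimplex hx
    have hz : ∀ t, rev x t = 0 := by
      intro t
      by_cases ht : 2 ≤ t ∧ t ≤ m + 1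
      · have := c (t - 2) (by omega)
        rw [show t - 2 + 2 = t by omega] at this
        linarith [hY (t - 2), hY (t - 2 + 3), hY t]
      · exact dif_neg ht
    rcases Nat.lt_or_ge i m with him | him
    · have := rev_add_one_sub x him
      rw [hz] at this
      exact hi.ne this
    · obtain rfl : i = Fin.last m := Fin.ext (by simp; omega)
      linarith
  have h0pos : 0 < x 0 := by
    by_contra hneg
    -- otherwise the largest index in the support of `rev x` leads to a payoff above `v`
    have key : ∀ t, t < m + 1 → rev x (m + 1 - t) = 0 := by
      intro t
      induction t using Nat.strong_induction_on with
      | _ t ih =>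
        intro ht
        rcases Nat.eq_zero_or_pos t with rfl | htpos
        · simpa [hx0] using le_antisymm (not_lt.1 hneg) (hx.1 0)
        by_contra hne
        have hp : 0 < rev x (m + 1 - t) := lt_of_le_of_ne (hY _) (Ne.symm hne)
        have hup : ∀ r, m + 1 - t < r → rev x r = 0 := by
          intro r hr
          by_cases hrm : r ≤ m + 1
          · have := ih (m + 1 - r) (by omega) (by omega)
            rwa [show m + 1 - (m + 1 - r) = r by omega] at this
          · exact rev_of_gt x (by omega)
        have h2 : 2 ≤ m + 1 - t := by
          by_contra hc
          rw [rev_of_lt x (by omega)] at hp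
          exact lt_irrefl _ hp
        obtain ⟨k, hk⟩ := Nat.exists_eq_add_of_le' h2
        have a := e (k + 1) (by omega) (by rw [show k + 1 + 1 = m + 1 - t by omega]; exact hp)
        rw [hup (k + 1 + 2) (by omega), hup (k + 1 + 3) (by omega)] at a
        have b := e k (by omega) (by linarith)
        rw [hup (k + 3) (by omega)] at b
        have hk2 : 2 ≤ k + 1 := by
          by_contra hc
          rw [rev_of_lt x (by omega)] at a
          linarith
        -- With `k + 2` the top of the support, `a` reads `rev x (k + 1) = v`, so this column would
        -- pay more than `v`.
        have d := c (k - 1) (by omega)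
        rw [show k - 1 + 2 = k + 1 by omega, show k - 1 + 3 = k + 2 by omega] at d
        rw [hk] at hp
        linarith [hY (k - 1)]
    have hlast : 0 < x (Fin.last m) := by
      obtain ⟨i, hi⟩ := exists_pos_of_mem_stdSimplex hx
      rcases Nat.lt_or_ge i m with him | him
      · have := rev_add_one_sub x him
        rw [key i (by omega)] at this
        exact absurd this hi.ne
      · obtain rfl : i = Fin.last m := Fin.ext (by simp; omega)
        exact hi
    have h2 := key (m - 1) (by omega)
    have h3 := key (m - 2) (by omega)
    rw [show m + 1 - (m - 1) = 2 by omega] at h2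
    rw [show m + 1 - (m - 2) = 3 by omega] at h3
    linarith [elast hlast]
  have hlastpos : 0 < x (Fin.last m) := by rw [e0 h0pos]; exact hvpos
  have hpos := band_pos hm hvpos hY (rev_of_lt x (by omega)) (rev_of_lt x (by omega))
    (rev_of_gt x (by omega)) (by rw [hx0]; exact h0pos) c (elast hlastpos) e
  intro i
  rcases Nat.lt_or_ge i m with him | him
  · have := rev_add_one_sub x him
    rw [← show x ⟨i, by omega⟩ = x i from rfl, ← this]
    exact hpos _ (by omega) (by omega)
  · obtain rfl : i = Fin.last m := Fin.ext (by simp; omega)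
    exact hlastpos

/-- The equilibria of `(1, beta (m + 1))` are given by the positive solutions of the band
system, together with the uniform distribution. -/
theorem isNash_iff (hm : 7 ≤ m) : IsNash 1 (beta (m + 1)) x y ↔
    (∀ i, 0 < x i) ∧ ∑ i, x i = 1 ∧ IsBandSolution m (x (Fin.last m)) (rev x) ∧
      y = fun _ => 1 / ((m : ℝ) + 1) := by
  constructor
  · intro h
    have hpos := h.pos hm
    obtain ⟨hx, hy, ⟨u, hu, hxu⟩, v, hv, hyv⟩ := isNash_one_iff.1 h
    have hyu : ∀ i, y i = u := fun i => hxu i (hpos i)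
    have hu1 : ((m : ℝ) + 1) * u = 1 := by
      have := hy.2
      simpa [hyu] using this
    have hu0 : 0 < u := by
      by_contra hc
      have : ((m : ℝ) + 1) * u ≤ 0 := mul_nonpos_of_nonneg_of_nonpos (by positivity) (not_lt.1 hc)
      linarith
    have hall : ∀ j, ∑ i, x i * (beta (m + 1) i j : ℝ) = v := fun j => hyv j (hyu j ▸ hu0)
    have hv0 : x (Fin.last m) = v := sum_mul_beta_zero x ▸ hall 0
    refine ⟨hpos, hx.2, ⟨rev_of_lt x (by omega), rev_of_lt x (by omega), rev_of_gt x (by omega),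
      fun k hk => ?_⟩, ?_⟩
    · rw [← sum_mul_beta_succ x hk, hv0]
      exact hall _
    · funext i
      rw [hyu i, eq_div_iff (by positivity), mul_comm]
      exact hu1
  · rintro ⟨hpos, hsum, hband, rfl⟩
    have hall : ∀ j, ∑ i, x i * (beta (m + 1) i j : ℝ) = x (Fin.last m) :=
      forall_fin_iff.2 ⟨sum_mul_beta_zero x, fun k hk => by
        rw [sum_mul_beta_succ x hk, hband.step k hk]⟩
    refine isNash_one_iff.2 ⟨⟨fun i => (hpos i).le, hsum⟩, ⟨fun i => ?_, ?_⟩,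
      ⟨_, fun i => le_rfl, fun i _ => rfl⟩, _, fun j => (hall j).le, fun j _ => hall j⟩
    · positivity
    · simp only [Finset.sum_const, Finset.card_univ, Fintype.card_fin, nsmul_eq_mul]
      push_cast
      field_simp

theorem apply_eq_rev_or_last {R : Type*} [Zero R] (x : Fin (m + 1) → R) (i : Fin (m + 1)) :
    (i : ℕ) < m ∧ x i = rev x (m + 1 - i) ∨ i = Fin.last m := by
  rcases Nat.lt_or_ge i m with him | him
  · exact Or.inl ⟨him, (rev_add_one_sub x him).symm⟩
  · exact Or.inr (Fin.ext (by simp; omega))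

theorem rev_snoc (Y : ℕ → ℝ) (v : ℝ) {t : ℕ} (h1 : 2 ≤ t) (h2 : t ≤ m + 1) :
    rev (fun i : Fin (m + 1) => if (i : ℕ) < m then Y (m + 1 - i) else v) t = Y t := by
  rw [rev, dif_pos ⟨h1, h2⟩]
  simp only
  rw [if_pos (by omega), show m + 1 - (m + 1 - t) = t by omega]

/-- Existence of an equilibrium whose entries are within a constant factor of each other. -/
theorem exists_isNash (hm : 7 ≤ m) : ∃ x y : Fin (m + 1) → ℝ, IsNash 1 (beta (m + 1)) x y ∧
    ∀ i, x (Fin.last m) ≤ 100 * x i := by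
  obtain ⟨Y, hY, hb⟩ := exists_isBandSolution hm
  set z : Fin (m + 1) → ℝ := fun i => if (i : ℕ) < m then Y (m + 1 - i) else 1 with hz
  have hzlast : z (Fin.last m) = 1 := by simp [hz]
  have hzb : ∀ i, 1 / 100 ≤ z i := by
    intro i
    simp only [hz]
    split_ifs with h
    · exact hb _ (by omega) (by omega)
    · norm_num
  have hrev : ∀ t ≤ m + 2, rev z t = Y t := by
    intro t ht
    obtain rfl | rfl | rfl | ⟨h1, h2⟩ : t = 0 ∨ t = 1 ∨ t = m + 2 ∨ (2 ≤ t ∧ t ≤ m + 1) := by omega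
    · rw [hY.zero]; exact rev_of_lt z (by omega)
    · rw [hY.one]; exact rev_of_lt z (by omega)
    · rw [hY.last]; exact rev_of_gt z (by omega)
    · exact rev_snoc Y 1 h1 h2
  have hS : 0 < ∑ i, z i :=
    Finset.sum_pos (fun i _ => lt_of_lt_of_le (by norm_num) (hzb i)) Finset.univ_nonempty
  have hrevx : ∀ t ≤ m + 2, rev (fun i => z i / ∑ i, z i) t = Y t / ∑ i, z i := by
    intro t ht
    rw [← hrev t ht]
    exact rev_map (fun r => r / ∑ i, z i) (zero_div _) z t
  refine ⟨fun i => z i / ∑ i, z i, fun _ => 1 / ((m : ℝ) + 1), (isNash_iff hm).2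
    ⟨fun i => div_pos (lt_of_lt_of_le (by norm_num) (hzb i)) hS, ?_, ⟨rev_of_lt _ (by omega),
      rev_of_lt _ (by omega), rev_of_gt _ (by omega), fun k hk => ?_⟩, rfl⟩, fun i => ?_⟩
  · rw [← Finset.sum_div, div_self hS.ne']
  · rw [hrevx _ (by omega), hrevx _ (by omega), hrevx _ (by omega), hzlast, ← hY.step k hk]
    ring
  · simp only
    rw [hzlast, ← mul_div_assoc]
    have := hzb i
    gcongr
    linarith

theorem IsNash.unique (hm : 7 ≤ m) {x' y' : Fin (m + 1) → ℝ} (h : IsNash 1 (beta (m + 1)) x y)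
    (h' : IsNash 1 (beta (m + 1)) x' y') : x = x' ∧ y = y' := by
  obtain ⟨hpos, hsum, hb, hy⟩ := (isNash_iff hm).1 h
  obtain ⟨hpos', hsum', hb', hy'⟩ := (isNash_iff hm).1 h'
  have hmul : ∀ i, x' (Fin.last m) * x i = x (Fin.last m) * x' i := by
    intro i
    rcases apply_eq_rev_or_last x i with ⟨hi, hxi⟩ | rfl
    · rw [hxi, show x' i = _ from (rev_add_one_sub x' hi).symm]
      exact hb.mul_eq_mul hb' (by omega)
    · ring
  -- Proportional vectors with the same sum 1 agree; summing `hmul` compares the last entries.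
  have hlast : x' (Fin.last m) = x (Fin.last m) := by
    have := Finset.sum_congr rfl fun i (_ : i ∈ Finset.univ) => hmul i
    rwa [← Finset.mul_sum, ← Finset.mul_sum, hsum, hsum', mul_one, mul_one] at this
  refine ⟨funext fun i => ?_, hy.trans hy'.symm⟩
  have := hmul i
  rw [hlast] at this
  exact mul_left_cancel₀ (hpos _).ne' this

theorem IsNash.last_le (hm : 7 ≤ m) (h : IsNash 1 (beta (m + 1)) x y) (i : Fin (m + 1)) :
    x (Fin.last m) ≤ 100 * x i := by
  obtain ⟨x', y', h', hb⟩ := exists_isNash hm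
  obtain ⟨rfl, -⟩ := h.unique hm h'
  exact hb i

theorem IsNash.le_last (hm : 7 ≤ m) (h : IsNash 1 (beta (m + 1)) x y) (i : Fin (m + 1)) :
    x i ≤ x (Fin.last m) := by
  obtain ⟨hpos, -, hb, -⟩ := (isNash_iff hm).1 h
  rcases apply_eq_rev_or_last x i with ⟨hi, hxi⟩ | rfl
  · have := hb.step (m - 1 - i) (by omega)
    rw [show m - 1 - (i : ℕ) + 2 = m + 1 - i by omega] at this
    have hn := rev_nonneg fun i => (hpos i).le
    linarith [hn (m - 1 - i), hn (m - 1 - i + 3)]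
  · exact le_rfl

end Nash

/-! ### The size of the numerators -/

section Numerators

variable {m : ℕ} {x y : Fin (m + 1) → ℝ}

/-- The entries of `x` are integral multiples of a common real number. -/
theorem IsNash.exists_int (hm : 7 ≤ m) (h : IsNash 1 (beta (m + 1)) x y) :
    ∃ (d : ℝ) (t : Fin (m + 1) → ℕ), 0 < d ∧ ∀ i, x i = d * t i := by
  obtain ⟨hpos, -, hb, -⟩ := (isNash_iff hm).1 h
  have hB : signedNarayana (m + 2) ≠ 0 := signedNarayana_ne_zero (by omega)
  have hint : ∀ i, ∃ a : ℤ, (signedNarayana (m + 2) : ℝ) * x i = a * x (Fin.last m) := by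
    intro i
    rcases apply_eq_rev_or_last x i with ⟨hi, hxi⟩ | rfl
    · exact ⟨_, hxi ▸ hb.signedNarayana_mul (by omega)⟩
    · exact ⟨_, rfl⟩
  choose a ha using hint
  have hBabs : (0 : ℝ) < |(signedNarayana (m + 2) : ℝ)| := abs_pos.2 (by exact_mod_cast hB)
  refine ⟨x (Fin.last m) / |(signedNarayana (m + 2) : ℝ)|, fun i => (a i).natAbs,
    div_pos (hpos _) hBabs, fun i => ?_⟩
  have h1 := congrArg abs (ha i)
  rw [abs_mul, abs_mul, abs_of_pos (hpos i), abs_of_pos (hpos _)] at h1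
  rw [Nat.cast_natAbs, Int.cast_abs, div_mul_eq_mul_div, eq_div_iff hBabs.ne']
  linarith

theorem IsNash.exists_isReducedForm (hm : 7 ≤ m) (h : IsNash 1 (beta (m + 1)) x y) :
    ∃ (p : Fin (m + 1) → ℕ) (q : ℕ), IsReducedForm x p q := by
  obtain ⟨d, t, hd, ht⟩ := h.exists_int hm
  obtain ⟨hpos, hsum, -, -⟩ := (isNash_iff hm).1 h
  obtain ⟨p, hp, hgcd⟩ := Finset.extract_gcd t Finset.univ_nonempty
  set g := Finset.univ.gcd t
  have hxp : ∀ i, x i = d * g * p i := by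
    intro i
    rw [ht i, hp i (Finset.mem_univ _)]
    push_cast
    ring
  have hs : d * g * ((∑ i, p i : ℕ) : ℝ) = 1 := by
    rw [← hsum, Nat.cast_sum, Finset.mul_sum]
    exact Finset.sum_congr rfl fun i _ => (hxp i).symm
  have hq : ((∑ i, p i : ℕ) : ℝ) ≠ 0 := by
    intro h0
    rw [h0, mul_zero] at hs
    exact zero_ne_one hs
  refine ⟨p, ∑ i, p i, Nat.pos_of_ne_zero (by exact_mod_cast hq), hgcd, fun i => ?_⟩
  rw [hxp i, eq_div_iff hq]
  linear_combination (p i : ℝ) * hs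

variable {p : Fin (m + 1) → ℕ} {q : ℕ}

theorem IsReducedForm.isBandSolution (hr : IsReducedForm x p q)
    (hb : IsBandSolution m (x (Fin.last m)) (rev x)) :
    IsBandSolution m (p (Fin.last m) : ℤ) (fun t => ((rev p t : ℕ) : ℤ)) := by
  obtain ⟨hq, -, hx⟩ := hr
  have hq0 : (q : ℝ) ≠ 0 := by exact_mod_cast hq.ne'
  have hrev : ∀ t, rev x t = ((rev p t : ℕ) : ℝ) / q := by
    intro t
    rw [← rev_map (fun a : ℕ => (a : ℝ) / q) (by simp) p t]
    congr 1
    exact funext hx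
  refine ⟨by simp [rev_of_lt p], by simp [rev_of_lt p], by simp [rev_of_gt p], fun k hk => ?_⟩
  have := hb.step k hk
  rw [hrev, hrev, hrev, hx, ← add_div, ← add_div, div_left_inj' hq0] at this
  exact_mod_cast this

theorem IsReducedForm.le_iff (hr : IsReducedForm x p q) {a : ℕ} {i j : Fin (m + 1)} :
    x i ≤ a * x j ↔ p i ≤ a * p j := by
  obtain ⟨hq, -, hx⟩ := hr
  have hq0 : (0 : ℝ) < q := by exact_mod_cast hq
  rw [hx, hx, ← mul_div_assoc, div_le_div_iff_of_pos_right hq0]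
  norm_cast

theorem IsNash.numerator_last_le (hm : 7 ≤ m) (h : IsNash 1 (beta (m + 1)) x y)
    (hr : IsReducedForm x p q) : p (Fin.last m) ≤ 2 ^ (m + 2) := by
  obtain ⟨-, -, hb, -⟩ := (isNash_iff hm).1 h
  have hbp := hr.isBandSolution hb
  have hdvd : ∀ i, p (Fin.last m) ∣ narayana (m + 2) * p i := by
    intro i
    rcases apply_eq_rev_or_last p i with ⟨hi, hpi⟩ | rfl
    · have h1 := hbp.signedNarayana_mul (k := m + 1 - i) (by omega)
      have h2 := congrArg Int.natAbs h1
      rw [Int.natAbs_mul, Int.natAbs_mul] at h2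
      simp only [Int.cast_id, Int.natAbs_natCast, natAbs_signedNarayana] at h2
      rw [hpi, h2]
      exact dvd_mul_left _ _
    · exact dvd_mul_left _ _
  have hg : p (Fin.last m) ∣ Finset.univ.gcd fun i => narayana (m + 2) * p i :=
    Finset.dvd_gcd fun i _ => hdvd i
  -- Since the numerators are coprime, the gcd of their multiples is `narayana (m + 2)` itself.
  rw [Finset.gcd_mul_left, hr.2.1] at hg
  have := Nat.le_of_dvd (narayana_pos (show 2 ≤ m + 2 by omega)) (by simpa using hg)
  exact this.trans (narayana_le_two_pow _)

theorem IsNash.bitLength_le (hm : 7 ≤ m) (h : IsNash 1 (beta (m + 1)) x y)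
    (hr : IsReducedForm x p q) : bitLength p ≤ (m + 1) * (m + 3) := by
  have hle : ∀ i ∈ Finset.univ, max 1 (Nat.digits 2 (p i)).length ≤ m + 3 := by
    intro i _
    have h1 : p i ≤ 2 ^ (m + 2) := by
      have := hr.le_iff (a := 1) (i := i) (j := Fin.last m)
      simp only [Nat.cast_one, one_mul] at this
      exact (this.1 (h.le_last hm i)).trans (h.numerator_last_le hm hr)
    refine max_le (by omega) ?_
    rw [Nat.digits_length_le_iff (by norm_num)]
    exact h1.trans_lt (Nat.pow_lt_pow_right (by norm_num) (by omega))
  have := Finset.sum_le_card_nsmul _ _ _ hle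
  simpa [bitLength] using this

theorem IsNash.le_bitLength (hm : 7 ≤ m) (h : IsNash 1 (beta (m + 1)) x y)
    (hr : IsReducedForm x p q) : (m + 1) * (m + 1) ≤ 444 * bitLength p := by
  obtain ⟨hpos, -, hb, -⟩ := (isNash_iff hm).1 h
  have hbp := hr.isBandSolution hb
  have hpl : ∀ i, p i ≤ p (Fin.last m) := by
    intro i
    have := hr.le_iff (a := 1) (i := i) (j := Fin.last m)
    simp only [Nat.cast_one, one_mul] at this
    exact this.1 (h.le_last hm i)
  have hV : 0 < p (Fin.last m) := by
    have h1 := hpos (Fin.last m)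
    rw [hr.2.2] at h1
    by_contra hc
    rw [Nat.eq_zero_of_not_pos hc] at h1
    simp at h1
  have hbound := five_quarters_pow_le hbp (by exact_mod_cast hV) (s := m / 12) (fun k _ => by
    refine ⟨by positivity, ?_⟩
    unfold rev
    split_ifs
    · exact_mod_cast hpl _
    · simp) (by omega)
  have hle : ∀ i ∈ Finset.univ, m + 1 ≤ 444 * max 1 (Nat.digits 2 (p i)).length := by
    intro i _
    set b := max 1 (Nat.digits 2 (p i)).length with hbdef
    have hb1 : 1 ≤ b := le_max_left _ _
    have h1 : p i < 2 ^ b :=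
      (Nat.digits_length_le_iff (by norm_num) _).1 (le_max_right _ _)
    have h2 : p (Fin.last m) ≤ 100 * p i := by
      have := hr.le_iff (a := 100) (i := Fin.last m) (j := i)
      exact this.1 (by exact_mod_cast h.last_le hm i)
    -- Here `2 * 100 ≤ 2 ^ 8`. With `2 ≤ (5 / 4) ^ 4` this gives `m / 12 ≤ 36 * b`, so `m + 1 ≤ 432
    -- * b + 12 ≤ 444 * b`.
    have h3 : 2 * p (Fin.last m) ≤ 2 ^ (9 * b) := by
      calc 2 * p (Fin.last m) ≤ 2 ^ 8 * 2 ^ b := by omega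
        _ ≤ 2 ^ (8 * b) * 2 ^ b := by
          gcongr
          · norm_num
          · omega
        _ = 2 ^ (9 * b) := by rw [← pow_add]; congr 1; omega
    have h4 : (5 / 4 : ℝ) ^ (m / 12) ≤ (5 / 4) ^ (36 * b) := by
      calc (5 / 4 : ℝ) ^ (m / 12) ≤ 2 * p (Fin.last m) := by exact_mod_cast hbound
        _ ≤ 2 ^ (9 * b) := by exact_mod_cast h3
        _ ≤ ((5 / 4) ^ 4) ^ (9 * b) := by
          gcongr
          norm_num
        _ = (5 / 4) ^ (36 * b) := by rw [← pow_mul]; congr 1; omega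
    have h5 : m / 12 ≤ 36 * b := (pow_le_pow_iff_right₀ (by norm_num)).1 h4
    omega
  have := Finset.card_nsmul_le_sum _ _ _ hle
  simpa [bitLength, Finset.mul_sum] using this

end Numerators

end BimatrixGame

theorem mainTheorem8 :
    ∃ M c C : ℝ, 0 < M ∧ 0 < c ∧ 0 < C ∧
      ∀ n : ℕ, 8 ≤ n →
        (∃! s : (Fin n → ℝ) × (Fin n → ℝ),
          BimatrixGame.IsNash (1 : Matrix (Fin n) (Fin n) ℤ) (BimatrixGame.beta n) s.1 s.2) ∧
        ∀ x y : Fin n → ℝ,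
          BimatrixGame.IsNash (1 : Matrix (Fin n) (Fin n) ℤ) (BimatrixGame.beta n) x y →
            (∀ i, 0 < x i) ∧
            (∀ i j, x i / x j ≤ M) ∧
            (∃ (p : Fin n → ℕ) (q : ℕ), BimatrixGame.IsReducedForm x p q) ∧
            ∀ (p : Fin n → ℕ) (q : ℕ), BimatrixGame.IsReducedForm x p q →
              c * (n : ℝ) ^ 2 ≤ (BimatrixGame.bitLength p : ℝ) ∧
              (BimatrixGame.bitLength p : ℝ) ≤ C * (n : ℝ) ^ 2 := by
  refine ⟨100, 1 / 444, 2, by norm_num, by norm_num, by norm_num, fun n hn => ?_⟩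
  obtain ⟨m, rfl⟩ := Nat.exists_eq_add_of_le' (show 1 ≤ n by omega)
  have hm : 7 ≤ m := by omega
  refine ⟨?_, fun x y h => ⟨h.pos hm, fun i j => ?_, h.exists_isReducedForm hm,
    fun p q hr => ⟨?_, ?_⟩⟩⟩
  · obtain ⟨x, y, h, -⟩ := BimatrixGame.exists_isNash hm
    refine ⟨(x, y), h, fun s hs => ?_⟩
    obtain ⟨h1, h2⟩ := BimatrixGame.IsNash.unique hm hs h
    exact Prod.ext h1 h2
  · rw [div_le_iff₀ (h.pos hm j)]
    exact (h.le_last hm i).trans (h.last_le hm j)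
  · have h1 : (((m + 1) * (m + 1) : ℕ) : ℝ) ≤ ((444 * BimatrixGame.bitLength p : ℕ) : ℝ) :=
      Nat.cast_le.2 (h.le_bitLength hm hr)
    push_cast at h1 ⊢
    linarith
  · have h1 : BimatrixGame.bitLength p ≤ 2 * (m + 1) ^ 2 :=
      (h.bitLength_le hm hr).trans (by nlinarith)
    exact_mod_cast h1
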